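/- Let $K$ be a field of characteristic $0$ and let $A\neq 0$ be a finite-dimensional commutative Frobenius algebra over $K$ with counit $\epsilon:A\to K$, Frobenius form $\eta(u,v)=\epsilon(uv)$, comultiplication $\delta:A\to A\otimes A$ (dual, under $\lambda:A\cong A^*$, $\langle\lambda(u),v\rangle=\eta(u,v)$, to the multiplication $m$) and Euler element $\mathbf e=m(\delta(\mathbf 1))$. For a basis $e_1,\dots,e_r$ of $A$ let $[\eta^{ab}]$ be the inverse of the matrix $[\eta(e_a,e_b)]$. A cell graph is the $1$-skeleton of a cell decomposition of a closed oriented surface with labeled vertices; $\Gamma_{g,n}$ is the set of connected cell graphs with $n$ labeled vertices on a surface of genus $g$ $(g\ge 0,\ n\ge 1)$. There are two edge-contraction operations. ECO 1 contracts an edge joining two distinct vertices $p_i,p_j$ to one vertex, labeled $i$. ECO 2 contracts a loop at a vertex $p_i$ and breaks $p_i$ into two vertices $p_{i_1}$, $p_{i_2}$, which receive the half-edges on the left and on the right of the (directed) loop; the result may be disconnected. Let $\omega$ be an ECO functor, evaluated at $A$: to every (possibly disconnected) cell graph $\gamma$ with $n$ labeled vertices it assigns a linear map $\omega_A(\gamma):A^{\otimes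 n}\to K$, depending only on the isomorphism class of $\gamma$, such that * $\omega_A(\emptyset)=1$, $\omega_A(\gamma\sqcup\gamma')=\omega_A(\gamma)\otimes\omega_A(\gamma')$, and $\omega_A(\bullet)=\epsilon$ for the graph $\bullet\in\Gamma_{0,1}$ without edges; * if $\gamma$ is connected and $\gamma'$ arises from $\gamma$ by ECO 1 at an edge from $p_i$ to $p_j$, then $\omega_A(\gamma)(\dots,v_i,\dots,v_j,\dots)=\omega_A(\gamma')(\dots,v_iv_j,\dots,\widehat{v_j},\dots)$; * if $\gamma$ is connected and $\gamma'$ arises from $\gamma$ by ECO 2 at a loop at $p_i$, then $\omega_A(\gamma)(\dots,v_i,\dots)=\omega_A(\gamma')(\dots,\delta(v_i),\dots)$, with $\delta(v_i)$ placed at $p_{i_1},p_{i_2}$. Then, for all $g\ge 0$ and $n\ge 1$, $\Gamma_{g,n}$ is non-empty and $\omega_A(\gamma)$ is the same map for all $\gamma\in\Gamma_{g,n}$, so that $\omega_{g,n}:=\omega_A(\gamma):A^{\otimes n}\to K$, for any $\gamma\in\Gamma_{g,n}$, is well defined. Moreover $$\omega_{g,n}(v_1,\dots,v_n)=\epsilon(v_1\cdots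 v_n\,\mathbf e^{g}),$$ and $(A,\{\omega_{g,n}\})$ is a 2D TQFT, that is, $\epsilon\ne 0$, $\omega_{0,1}=\epsilon$, $\omega_{0,2}=\eta$, and in the stable range $2g-2+n>0$ the maps form a cohomological field theory with values in $H^0(\overline{\mathcal M}_{g,n},K)=K$: * $\omega_{g,n}$ is $S_n$-invariant, and $\omega_{0,3}(v_1,v_2,v_3)=\eta(v_1v_2,v_3)$; * $\omega_{g,n+1}(v_1,\dots,v_n,\mathbf 1)=\omega_{g,n}(v_1,\dots,v_n)$ for $(g,n)$ stable, $n\ge1$; * $\omega_{g,n}(v_1,\dots,v_n)=\sum_{a,b}\omega_{g-1,n+2}(v_1,\dots,v_n,e_a,e_b)\,\eta^{ab}$ for $g,n\ge 1$; * $\omega_{g_1+g_2,m+n}(v_1,\dots,v_m,w_1,\dots,w_n)=\sum_{a,b}\eta^{ab}\,\omega_{g_1,m+1}(v_1,\dots,v_m,e_a)\,\omega_{g_2,n+1}(w_1,\dots,w_n,e_b)$ for $m+n\ge 1$ and $(g_1,m+1)$, $(g_2,n+1)$ stable. The last two hold for every basis $e_1,\dots,e_r$ of $A$. -/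

import Mathlib

open scoped TensorProduct

/-! ### Permutations: erasing a point, and the cycles of `p * swap h k` -/

namespace CellPerm

open Equiv Equiv.Perm

theorem sameCycle_le {α : Type*} {p : Perm α} {R : α → α → Prop} (hR : Equivalence R)
    (h : ∀ x, R x (p x)) {x y : α} (hxy : p.SameCycle x y) : R x y := by
  obtain ⟨n, rfl⟩ := hxy
  induction n using Int.induction_on with
  | zero => simpa using hR.refl x
  | succ n ih =>
    refine hR.trans ih ?_
    have := h ((p ^ (n : ℤ)) x)
    rwa [← Perm.mul_apply, ← zpow_one_add, add_comm] at this
  | pred n ih =>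
    refine hR.trans ih (hR.symm ?_)
    have := h ((p ^ (-(n : ℤ) - 1)) x)
    rwa [← Perm.mul_apply, ← zpow_one_add, add_sub_cancel] at this

/-- The permutation that fixes `a` and otherwise is `p` with the point `a` skipped:
the cycle `(… x a y …)` of `p` becomes `(… x y …)`. -/
noncomputable def skip {α : Type*} (p : Perm α) (a : α) : Perm α :=
  open Classical in swap a (p a) * p

theorem skip_self {α : Type*} (p : Perm α) (a : α) : skip p a a = a := by
  simp [skip]

theorem skip_of_eq {α : Type*} {p : Perm α} {a x : α} (h : p x = a) : skip p a x = p a := by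
  simp [skip, h]

theorem skip_of_ne {α : Type*} {p : Perm α} {a x : α} (hx : x ≠ a) (h : p x ≠ a) :
    skip p a x = p x := by
  classical
  have : p x ≠ p a := fun e => hx (p.injective e)
  simp [skip, swap_apply_of_ne_of_ne h this]

theorem sameCycle_skip {α : Type*} (p : Perm α) {a x y : α} (hx : x ≠ a) (hy : y ≠ a) :
    (skip p a).SameCycle x y ↔ p.SameCycle x y := by
  classical
  constructor
  · refine sameCycle_le (R := p.SameCycle) (SameCycle.equivalence p) fun z => ?_
    by_cases hz : z = a
    · subst hz; rw [skip_self]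
    · by_cases hpz : p z = a
      · rw [skip_of_eq hpz, ← hpz, sameCycle_apply_right, sameCycle_apply_right]
      · rw [skip_of_ne hz hpz, sameCycle_apply_right]
  · intro h
    let f : α → α := fun z => if z = a then p a else z
    have key : (skip p a).SameCycle (f x) (f y) := by
      refine sameCycle_le (p := p) (R := fun u w => (skip p a).SameCycle (f u) (f w))
        ((SameCycle.equivalence (skip p a)).comap f) (fun z => ?_) h
      by_cases hz : z = a
      · subst hz
        by_cases hpz : p z = z
        · rw [hpz]
        · simp only [f, if_true, if_neg hpz, SameCycle.refl]
      · by_cases hpz : p z = a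
        · simp only [f, hpz, if_true, if_neg hz]
          rw [← skip_of_eq hpz, sameCycle_apply_right]
        · simp only [f, if_neg hz, if_neg hpz]
          rw [← skip_of_ne hz hpz, sameCycle_apply_right]
    simpa only [f, if_neg hx, if_neg hy] using key

/-- `p * swap h k`: it joins the cycles of `h` and `k` if they are distinct, and cuts the cycle in
two if `h` and `k` lie on the same one. -/
noncomputable def cut {α : Type*} (p : Perm α) (h k : α) : Perm α :=
  open Classical in p * swap h k

theorem cut_left {α : Type*} (p : Perm α) (h k : α) : cut p h k h = p k := by simp [cut]

theorem cut_right {α : Type*} (p : Perm α) (h k : α) : cut p h k k = p h := by simp [cut]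

theorem cut_of_ne {α : Type*} (p : Perm α) {h k x : α} (h1 : x ≠ h) (h2 : x ≠ k) :
    cut p h k x = p x := by
  classical
  simp [cut, swap_apply_of_ne_of_ne h1 h2]

theorem cut_cut {α : Type*} (p : Perm α) (h k : α) : cut (cut p h k) h k = p := by
  simp [cut, mul_assoc]

/-- A cycle of `p` is contained in a cycle of `cut p h k`, up to joining the cycles of `h`
and `k`. -/
theorem sameCycle_cut_or {α : Type*} (p : Perm α) (h k : α) {x y : α} (hxy : p.SameCycle x y) :
    (cut p h k).SameCycle x y ∨
      (((cut p h k).SameCycle x h ∨ (cut p h k).SameCycle x k) ∧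
        ((cut p h k).SameCycle y h ∨ (cut p h k).SameCycle y k)) := by
  set q := cut p h k with hq
  refine sameCycle_le (p := p) (R := fun x y => q.SameCycle x y ∨
    ((q.SameCycle x h ∨ q.SameCycle x k) ∧ (q.SameCycle y h ∨ q.SameCycle y k)))
    ⟨fun x => Or.inl (SameCycle.refl q x), ?_, ?_⟩ (fun z => ?_) hxy
  · rintro x y (h | ⟨h1, h2⟩)
    · exact Or.inl h.symm
    · exact Or.inr ⟨h2, h1⟩
  · rintro x y z (h1 | ⟨h1, h1'⟩) (h2 | ⟨h2, h2'⟩)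
    · exact Or.inl (h1.trans h2)
    · exact Or.inr ⟨h2.imp h1.trans h1.trans, h2'⟩
    · exact Or.inr ⟨h1, h1'.imp h2.symm.trans h2.symm.trans⟩
    · exact Or.inr ⟨h1, h2'⟩
  · by_cases h1 : z = h
    · subst h1
      refine Or.inr ⟨Or.inl (SameCycle.refl _ _), Or.inr ?_⟩
      rw [← cut_right p z k, ← hq, sameCycle_apply_left]
    · by_cases h2 : z = k
      · subst h2
        refine Or.inr ⟨Or.inr (SameCycle.refl _ _), Or.inl ?_⟩
        rw [← cut_left p h z, ← hq, sameCycle_apply_left]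
      · left
        rw [← cut_of_ne p h1 h2, ← hq, sameCycle_apply_right]

theorem not_sameCycle_cut {α : Type*} [Finite α] (p : Perm α) {h k : α} (hne : h ≠ k)
    (hp : p.SameCycle h k) : ¬ (cut p h k).SameCycle k h := by
  classical
  have hex : ∃ m : ℕ, (p ^ m) h = k := hp.exists_nat_pow_eq
  set m := Nat.find hex with hm
  have hmk : (p ^ m) h = k := Nat.find_spec hex
  have hlt : ∀ t < m, (p ^ t) h ≠ k := fun t ht => Nat.find_min hex ht
  have hm0 : m ≠ 0 := by
    intro h0
    rw [h0] at hmk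
    exact hne (by simpa using hmk)
  have hnh : ∀ t, 1 ≤ t → t ≤ m → (p ^ t) h ≠ h := by
    intro t h1 h2 h3
    refine hlt (m - t) (by omega) ?_
    have : (p ^ (m - t)) ((p ^ t) h) = k := by
      rw [← Perm.mul_apply, ← pow_add, Nat.sub_add_cancel h2, hmk]
    rwa [h3] at this
  have key : ∀ n : ℕ, ∃ t, 1 ≤ t ∧ t ≤ m ∧ ((cut p h k) ^ n) k = (p ^ t) h := by
    intro n
    induction n with
    | zero => exact ⟨m, by omega, le_rfl, by simp [hmk]⟩
    | succ n ih =>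
      obtain ⟨t, h1, h2, h3⟩ := ih
      rw [pow_succ', Perm.mul_apply, h3]
      by_cases ht : t = m
      · refine ⟨1, le_rfl, by omega, ?_⟩
        rw [ht, hmk, cut_right, pow_one]
      · refine ⟨t + 1, by omega, by omega, ?_⟩
        rw [cut_of_ne p (hnh t h1 h2) (hlt t (by omega)), pow_succ', Perm.mul_apply]
  intro hc
  obtain ⟨n, hn⟩ := hc.exists_nat_pow_eq
  obtain ⟨t, h1, h2, h3⟩ := key n
  exact hnh t h1 h2 (h3.symm.trans hn)

theorem sameCycle_cut {α : Type*} [Finite α] (p : Perm α) {h k : α}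
    (hp : ¬ p.SameCycle h k) : (cut p h k).SameCycle h k := by
  by_contra hc
  rcases sameCycle_cut_or (cut p h k) h k
    (x := h) (y := p k) (by rw [← cut_left p h k, sameCycle_apply_right]) with h1 | ⟨-, h1⟩
  · rw [cut_cut, sameCycle_apply_right] at h1
    exact hp h1
  · clear h1
    have hk : ∀ n : ℕ, (p ^ n) k ≠ h := fun n hn => hp (SameCycle.symm ⟨n, by simpa using hn⟩)
    have key : ∀ n : ℕ, (cut p h k).SameCycle h ((p ^ (n + 1)) k) ∨
        (cut p h k).SameCycle h k := by
      intro n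
      induction n with
      | zero =>
        left
        rw [zero_add, pow_one, ← cut_left p h k, sameCycle_apply_right]
      | succ n ih =>
        refine ih.elim (fun ih => ?_) Or.inr
        by_cases hnk : (p ^ (n + 1)) k = k
        · right; rwa [hnk] at ih
        · left
          rw [pow_succ', Perm.mul_apply, ← cut_of_ne p (hk (n + 1)) hnk, sameCycle_apply_right]
          exact ih
    obtain ⟨n, hn⟩ : ∃ n : ℕ, (p ^ (n + 1)) k = k := by
      refine ⟨orderOf p - 1, ?_⟩
      rw [Nat.sub_add_cancel (orderOf_pos p), pow_orderOf_eq_one, Perm.one_apply]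
    have := key n
    rw [hn, or_self] at this
    exact hc this

end CellPerm

/-! ### Cell graphs -/

/-- A cell graph (possibly disconnected) with vertices labelled by `V`: the `1`-skeleton of a cell
decomposition of a closed oriented surface, recorded by its rotation system. `H` is the set of
half-edges, `rot h` is the half-edge that follows `h` counterclockwise around its vertex, `inv h` is
the other half of the edge of `h`, and `vert h` is the vertex to which `h` is incident. The
half-edges at a vertex form one cycle of `rot`; a vertex may have degree `0`. -/
structure CellGraph (V : Type) where
  H : Type
  [finite_H : Finite H]
  rot : Equiv.Perm H
  inv : Equiv.Perm H
  inv_inv : ∀ h, inv (inv h) = h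
  inv_ne : ∀ h, inv h ≠ h
  vert : H → V
  vert_eq_iff : ∀ h k, vert h = vert k ↔ rot.SameCycle h k

namespace CellGraph

open CellPerm Equiv Equiv.Perm

attribute [instance] CellGraph.finite_H

variable {V : Type}

theorem vert_rot (γ : CellGraph V) (h : γ.H) : γ.vert (γ.rot h) = γ.vert h := by
  rw [γ.vert_eq_iff, sameCycle_apply_left]

/-- Isomorphism of cell graphs keeping the labels of the vertices (orientation-preserving
homeomorphism of the surfaces, carrying one labelled cell decomposition to the other). -/
structure Iso (γ γ' : CellGraph V) where
  toEquiv : γ.H ≃ γ'.H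
  map_rot : ∀ h, toEquiv (γ.rot h) = γ'.rot (toEquiv h)
  map_inv : ∀ h, toEquiv (γ.inv h) = γ'.inv (toEquiv h)
  map_vert : ∀ h, γ'.vert (toEquiv h) = γ.vert h

/-- Two vertices are joined by an edge. -/
def Adj (γ : CellGraph V) (u v : V) : Prop :=
  ∃ h : γ.H, γ.vert h = u ∧ γ.vert (γ.inv h) = v

def Connected (γ : CellGraph V) : Prop :=
  Nonempty V ∧ ∀ u v : V, Relation.ReflTransGen γ.Adj u v

/-- Number of edges: orbits of `inv` on half-edges. -/
noncomputable def numEdges (γ : CellGraph V) : ℕ :=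
  Nat.card (Quotient (SameCycle.setoid γ.inv))

/-- Number of faces. The boundary of a face runs along an edge and then turns to the next half-edge
at the vertex it reaches, so the faces meeting some edge are the cycles of `rot * inv`. Besides,
each vertex of degree `0` is alone on a sphere, whose other cell is a face without edges. -/
noncomputable def numFaces (γ : CellGraph V) : ℕ :=
  Nat.card (Quotient (SameCycle.setoid (γ.rot * γ.inv))) +
    Nat.card {v : V // ∀ h, γ.vert h ≠ v}

/-- Euler characteristic of the surface. -/
noncomputable def eulerChar (γ : CellGraph V) : ℤ :=
  (Nat.card V : ℤ) - γ.numEdges + γ.numFaces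

/-- The set `Γ_{g,n}` of connected cell graphs of type `(g,n)`: genus `g`, with `n` vertices
labelled by `Fin n`. -/
def ofType (g n : ℕ) : Set (CellGraph (Fin n)) :=
  {γ | γ.Connected ∧ γ.eulerChar = 2 - 2 * (g : ℤ)}

/-- The part of a cell graph on a set `S` of vertices that is a union of connected components. -/
def restrict (γ : CellGraph V) (S : Set V)
    (hS : ∀ h : γ.H, γ.vert (γ.inv h) ∈ S ↔ γ.vert h ∈ S) : CellGraph S where
  H := {h : γ.H // γ.vert h ∈ S}
  rot := γ.rot.subtypePerm fun h => by rw [γ.vert_rot]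
  inv := γ.inv.subtypePerm hS
  inv_inv h := Subtype.ext (γ.inv_inv h)
  inv_ne h e := γ.inv_ne h (congrArg Subtype.val e)
  vert h := ⟨γ.vert h, h.2⟩
  vert_eq_iff h k := by
    rw [sameCycle_subtypePerm, Subtype.mk_eq_mk, γ.vert_eq_iff]

/-! #### Edge contraction

Let `h` and `k = inv h` be the two halves of an edge, directed from `h` to `k`. If the edge joins
two vertices, around which the half-edges are `(h a₁ … aᵣ)` and `(k b₁ … bₛ)` counterclockwise, then
they are `(a₁ … aᵣ b₁ … bₛ)` around the vertex to which the edge is contracted. If the edge is a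
loop at a vertex with the half-edges `(h a₁ … aᵣ k b₁ … bₛ)`, then its contraction breaks the vertex
into one with `(a₁ … aᵣ)`, on the left of the directed loop, and one with `(b₁ … bₛ)`, on its right.
In both cases the new rotation is `rot * swap h k` with `h` and `k` skipped. -/

/-- The half-edges that remain when the edge of `h` is contracted. -/
abbrev Rest (γ : CellGraph V) (h : γ.H) : Type := {x : γ.H // x ≠ h ∧ x ≠ γ.inv h}

/-- `rot * swap h (inv h)`. -/
noncomputable def cutRot (γ : CellGraph V) (h : γ.H) : Perm γ.H := cut γ.rot h (γ.inv h)

theorem skip_skip_mem (γ : CellGraph V) (h x : γ.H) :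
    (skip (skip (γ.cutRot h) h) (γ.inv h) x ≠ h ∧
      skip (skip (γ.cutRot h) h) (γ.inv h) x ≠ γ.inv h) ↔ (x ≠ h ∧ x ≠ γ.inv h) := by
  have h1 : skip (skip (γ.cutRot h) h) (γ.inv h) (γ.inv h) = γ.inv h := skip_self _ _
  have h2 : skip (skip (γ.cutRot h) h) (γ.inv h) h = h := by
    rw [skip_of_ne (γ.inv_ne h).symm, skip_self]
    rw [skip_self]; exact (γ.inv_ne h).symm
  refine and_congr (not_congr ?_) (not_congr ?_)
  · exact ⟨fun e => Equiv.injective _ (e.trans h2.symm), fun e => by rw [e]; exact h2⟩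
  · exact ⟨fun e => Equiv.injective _ (e.trans h1.symm), fun e => by rw [e]; exact h1⟩

noncomputable def contractRot (γ : CellGraph V) (h : γ.H) : Perm (γ.Rest h) :=
  (skip (skip (γ.cutRot h) h) (γ.inv h)).subtypePerm (γ.skip_skip_mem h)

def contractInv (γ : CellGraph V) (h : γ.H) : Perm (γ.Rest h) :=
  γ.inv.subtypePerm fun x => by
    have : γ.inv x = h ↔ x = γ.inv h :=
      ⟨fun e => by rw [← e, γ.inv_inv], fun e => by rw [e, γ.inv_inv]⟩
    rw [Ne, Ne, this, Equiv.apply_eq_iff_eq, and_comm]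

theorem sameCycle_contractRot (γ : CellGraph V) (h : γ.H) (x y : γ.Rest h) :
    (γ.contractRot h).SameCycle x y ↔ (γ.cutRot h).SameCycle x y := by
  rw [contractRot, sameCycle_subtypePerm, sameCycle_skip _ x.2.2 y.2.2,
    sameCycle_skip _ x.2.1 y.2.1]

theorem vert_eq_of_sameCycle_cutRot (γ : CellGraph V) (h : γ.H) {x y : γ.H}
    (hxy : (γ.cutRot h).SameCycle x y) :
    γ.vert x = γ.vert y ∨ ((γ.vert x = γ.vert h ∨ γ.vert x = γ.vert (γ.inv h)) ∧
      (γ.vert y = γ.vert h ∨ γ.vert y = γ.vert (γ.inv h))) := by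
  have := sameCycle_cut_or (γ.cutRot h) h (γ.inv h) hxy
  rw [cutRot, cut_cut] at this
  simpa only [γ.vert_eq_iff] using this

/-- **ECO 1.** Contraction of the edge directed from `h` to `inv h` that joins two distinct
vertices `i = vert h` and `j = vert (inv h)`. The new vertex is labelled by `i`. -/
noncomputable def contractEdge (γ : CellGraph V) (h : γ.H) (hne : γ.vert h ≠ γ.vert (γ.inv h)) :
    CellGraph {v : V // v ≠ γ.vert (γ.inv h)} where
  H := γ.Rest h
  rot := γ.contractRot h
  inv := γ.contractInv h
  inv_inv x := Subtype.ext (γ.inv_inv x)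
  inv_ne x e := γ.inv_ne x (congrArg Subtype.val e)
  vert x := open Classical in
    if hx : γ.vert x = γ.vert (γ.inv h) then ⟨γ.vert h, hne⟩ else ⟨γ.vert x, hx⟩
  vert_eq_iff x y := by
    have hjoin : (γ.cutRot h).SameCycle h (γ.inv h) :=
      sameCycle_cut _ (by rwa [← γ.vert_eq_iff])
    have key : (γ.cutRot h).SameCycle x y ↔ (γ.vert x = γ.vert y ∨
        ((γ.vert x = γ.vert h ∨ γ.vert x = γ.vert (γ.inv h)) ∧
          (γ.vert y = γ.vert h ∨ γ.vert y = γ.vert (γ.inv h)))) := by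
      refine ⟨γ.vert_eq_of_sameCycle_cutRot h, ?_⟩
      have hto : ∀ z : γ.H, (γ.vert z = γ.vert h ∨ γ.vert z = γ.vert (γ.inv h)) →
          (γ.cutRot h).SameCycle z h := by
        rintro z (hz | hz)
        · rcases sameCycle_cut_or γ.rot h (γ.inv h) ((γ.vert_eq_iff z h).1 hz) with
            h1 | ⟨h1 | h1, -⟩
          exacts [h1, h1, SameCycle.trans h1 hjoin.symm]
        · rcases sameCycle_cut_or γ.rot h (γ.inv h) ((γ.vert_eq_iff z _).1 hz) with
            h1 | ⟨h1 | h1, -⟩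
          exacts [SameCycle.trans h1 hjoin.symm, h1, SameCycle.trans h1 hjoin.symm]
      rintro (hxy | ⟨hx, hy⟩)
      · rcases sameCycle_cut_or γ.rot h (γ.inv h) ((γ.vert_eq_iff x y).1 hxy) with
          h1 | ⟨h1, h2⟩
        · exact h1
        · have aux : ∀ z : γ.H, ((cut γ.rot h (γ.inv h)).SameCycle z h ∨
              (cut γ.rot h (γ.inv h)).SameCycle z (γ.inv h)) → (γ.cutRot h).SameCycle z h :=
            fun z hz => hz.elim id fun hz => SameCycle.trans hz hjoin.symm
          exact (aux _ h1).trans (aux _ h2).symm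
      · exact (hto _ hx).trans (hto _ hy).symm
    rw [sameCycle_contractRot, key]
    by_cases hx : γ.vert x = γ.vert (γ.inv h) <;> by_cases hy : γ.vert y = γ.vert (γ.inv h) <;>
      simp only [hx, hy, dif_pos, dif_neg, not_false_eq_true, Subtype.mk_eq_mk] <;> grind

/-- **ECO 2.** Contraction of the loop directed from `h` to `inv h` at the vertex `i = vert h`,
which is broken into a vertex `i₁`, on the left of the directed loop, and a vertex `i₂`, on its
right. In `Option V` the label of `i₁` is `some i`, that of `i₂` is `none`, and any other vertex `u`
is labelled by `some u`. The result may be disconnected. -/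
noncomputable def contractLoop (γ : CellGraph V) (h : γ.H) (hl : γ.vert h = γ.vert (γ.inv h)) :
    CellGraph (Option V) where
  H := γ.Rest h
  rot := γ.contractRot h
  inv := γ.contractInv h
  inv_inv x := Subtype.ext (γ.inv_inv x)
  inv_ne x e := γ.inv_ne x (congrArg Subtype.val e)
  vert x := open Classical in
    if (γ.cutRot h).SameCycle x h then none else some (γ.vert x)
  vert_eq_iff x y := by
    have hdis : ¬ (γ.cutRot h).SameCycle (γ.inv h) h :=
      not_sameCycle_cut _ (γ.inv_ne h).symm ((γ.vert_eq_iff _ _).1 hl)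
    rw [sameCycle_contractRot]
    by_cases hx : (γ.cutRot h).SameCycle x h <;> by_cases hy : (γ.cutRot h).SameCycle y h
    · simpa only [hx, hy, if_true, true_iff] using hx.trans hy.symm
    · simp only [hx, hy, if_true, if_false, reduceCtorEq, false_iff]
      exact fun hxy => hy (hxy.symm.trans hx)
    · simp only [hx, hy, if_true, if_false, reduceCtorEq, false_iff]
      exact fun hxy => hx (hxy.trans hy)
    · simp only [hx, hy, if_false, Option.some.injEq]
      constructor
      · intro hxy
        rcases sameCycle_cut_or γ.rot h (γ.inv h) ((γ.vert_eq_iff x y).1 hxy) with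
          h1 | ⟨h1, h2⟩
        · exact h1
        · exact SameCycle.trans (h1.resolve_left hx) (h2.resolve_left hy).symm
      · intro hxy
        have := γ.vert_eq_of_sameCycle_cutRot h hxy
        rw [← hl, or_self, or_self] at this
        exact this.elim id fun e => e.1.trans e.2.symm

end CellGraph

/-! ### Commutative Frobenius algebras -/

/-- The structure of a Frobenius algebra on a commutative `K`-algebra `A` (always taken
finite-dimensional below): a counit such that `counit (u * x) = 0` for all `x` implies `u = 0`. -/
structure FrobeniusStructure (K A : Type*) [Field K] [CommRing A] [Algebra K A] where
  counit : A →ₗ[K] K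
  nondeg : ∀ u : A, (∀ x : A, counit (u * x) = 0) → u = 0

namespace FrobeniusStructure

variable {K A : Type*} [Field K] [CommRing A] [Algebra K A]

/-- The Frobenius form `η(u,v) = ε(uv)`. -/
def eta (F : FrobeniusStructure K A) : LinearMap.BilinForm K A :=
  (LinearMap.mul K A).compr₂ F.counit

theorem eta_apply (F : FrobeniusStructure K A) (u v : A) : F.eta u v = F.counit (u * v) := rfl

theorem eta_nondegenerate (F : FrobeniusStructure K A) : F.eta.Nondegenerate :=
  ⟨fun u hu => F.nondeg u hu, fun u hu => F.nondeg u fun x => by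
    have := hu x
    rwa [eta_apply, mul_comm] at this⟩

variable [FiniteDimensional K A]

/-- The isomorphism `λ : A → A*`, `⟨λ(u),v⟩ = η(u,v)`. -/
noncomputable def lam (F : FrobeniusStructure K A) : A ≃ₗ[K] Module.Dual K A :=
  F.eta.toDual F.eta_nondegenerate

/-- The comultiplication `δ : A → A ⊗ A`, defined by `(λ ⊗ λ) ∘ δ = m* ∘ λ`, where
`m* : A* → (A ⊗ A)* = A* ⊗ A*` is the dual of the multiplication. (As `A` is commutative, it does
not matter in which order the factors of `A* ⊗ A*` and `A ⊗ A` are paired.) -/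
noncomputable def comul (F : FrobeniusStructure K A) : A →ₗ[K] A ⊗[K] A :=
  (TensorProduct.congr F.lam F.lam).symm.toLinearMap ∘ₗ
    (TensorProduct.dualDistribEquiv K A A).symm.toLinearMap ∘ₗ
      (LinearMap.mul' K A).dualMap ∘ₗ F.lam.toLinearMap

/-- The Euler element `e = m(δ(1))`. -/
noncomputable def euler (F : FrobeniusStructure K A) : A :=
  LinearMap.mul' K A (F.comul 1)

/-- The coefficient `η^{ab}`: the entry of the inverse of the matrix `[η(e_a,e_b)]`. -/
noncomputable def etaInv (F : FrobeniusStructure K A) {r : ℕ} (e : Module.Basis (Fin r) K A)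
    (a b : Fin r) : K :=
  (Matrix.of fun i j => F.eta (e i) (e j))⁻¹ a b

end FrobeniusStructure

/-! ### The ECO functor at a Frobenius algebra -/

open Classical in
/-- For a multilinear function `f` of variables indexed by `Option V`, a vertex `i` and `v : V → A`,
the bilinear function `(a, b) ↦ f(…, a, b, …)`, in which `v i` is replaced by the two entries `a`, in
the place of `i₁ = some i`, and `b`, in the place of `i₂ = none`. -/
noncomputable def splitEval {K A : Type*} [Field K] [CommRing A] [Algebra K A] {V : Type}
    (f : MultilinearMap K (fun _ : Option V => A) K) (i : V) (v : V → A) : A →ₗ[K] A →ₗ[K] K :=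
  LinearMap.mk₂ K
    (fun a b => f (Function.update (Function.update (fun u => u.elim 0 v) (some i) a) none b))
    (fun a a' b => by
      simp only [Function.update_comm (show some i ≠ (none : Option V) by simp), f.map_update_add])
    (fun c a b => by
      simp only [Function.update_comm (show some i ≠ (none : Option V) by simp),
        f.map_update_smul])
    (fun a b b' => by simp only [f.map_update_add])
    (fun c a b => by simp only [f.map_update_smul])

/-- The value at the Frobenius algebra `A` of an ECO functor: a cell graph `γ` with vertices labelled
by `V` goes to a linear function `ω_A(γ) : A^{⊗V} → K`, that is to the object `(A^{⊗V}, ω_A(γ))` of the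
category of vector spaces over `K`; disjoint unions go to tensor products; the graph `•` goes to
`(A, ε)`; and the edge-contraction operations `γ → γ'` go to morphisms
`(A^{⊗V}, ω_A(γ)) → (A^{⊗V'}, ω_A(γ'))` over `K`, given by the multiplication of `A` for ECO 1 and by
the comultiplication of `A` for ECO 2. -/
structure ECOFunctor {K A : Type*} [Field K] [CommRing A] [Algebra K A] [FiniteDimensional K A]
    (F : FrobeniusStructure K A) where
  /-- `ω_A(γ)`. -/
  val : ∀ {V : Type} [Finite V], CellGraph V → MultilinearMap K (fun _ : V => A) K
  val_iso : ∀ {V : Type} [Finite V] {γ γ' : CellGraph V}, Nonempty (γ.Iso γ') → val γ = val γ'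
  val_empty : ∀ {V : Type} [Finite V] [IsEmpty V] (γ : CellGraph V) (v : V → A), val γ v = 1
  val_union : ∀ {V : Type} [Finite V] (γ : CellGraph V) (S : Set V)
    (hS : ∀ h : γ.H, γ.vert (γ.inv h) ∈ S ↔ γ.vert h ∈ S) (v : V → A),
    val γ v = val (γ.restrict S hS) (fun u => v u) *
      val (γ.restrict Sᶜ fun h => not_congr (hS h)) (fun u => v u)
  val_point : ∀ {V : Type} [Finite V] [Unique V] (γ : CellGraph V) [IsEmpty γ.H] (v : V → A),
    val γ v = F.counit (v default)
  eco_one : ∀ {V : Type} [Finite V] (γ : CellGraph V), γ.Connected → ∀ (h : γ.H)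
    (hne : γ.vert h ≠ γ.vert (γ.inv h)) (v : V → A),
    val γ v = val (γ.contractEdge h hne)
      (fun u => open Classical in
        if u.1 = γ.vert h then v (γ.vert h) * v (γ.vert (γ.inv h)) else v u)
  eco_two : ∀ {V : Type} [Finite V] (γ : CellGraph V), γ.Connected → ∀ (h : γ.H)
    (hl : γ.vert h = γ.vert (γ.inv h)) (v : V → A),
    val γ v = TensorProduct.lift (splitEval (val (γ.contractLoop h hl)) (γ.vert h) v)
      (F.comul (v (γ.vert h)))

/-! ### Two-dimensional topological quantum field theories -/

/-- A system of linear maps `ω_{g,n} : A^{⊗n} → K`, `g ≥ 0`, `n ≥ 1`, is a 2D TQFT on the Frobenius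
algebra `A`: in the stable range `2g - 2 + n > 0` it is a cohomological field theory with values in
`H⁰ = K`, and it is the counit for `(g,n) = (0,1)` and the Frobenius form for `(g,n) = (0,2)`. -/
structure IsTQFT {K A : Type*} [Field K] [CommRing A] [Algebra K A] (F : FrobeniusStructure K A)
    (W : ∀ (_ n : ℕ) [NeZero n], MultilinearMap K (fun _ : Fin n => A) K) : Prop where
  counit_ne_zero : F.counit ≠ 0
  zero_one : ∀ v : Fin 1 → A, W 0 1 v = F.counit (v 0)
  zero_two : ∀ v : Fin 2 → A, W 0 2 v = F.eta (v 0) (v 1)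
  symm : ∀ (g n : ℕ) [NeZero n], 2 < 2 * g + n → ∀ (s : Equiv.Perm (Fin n)) (v : Fin n → A),
    W g n (v ∘ s) = W g n v
  zero_three : ∀ v : Fin 3 → A, W 0 3 v = F.eta (v 0 * v 1) (v 2)
  unit : ∀ (g n : ℕ) [NeZero n], 2 < 2 * g + n → ∀ v : Fin n → A,
    W g (n + 1) (Fin.snoc v 1) = W g n v
  glue_self : ∀ (g n : ℕ) [NeZero n] (r : ℕ) (e : Module.Basis (Fin r) K A) (v : Fin n → A),
    2 < 2 * (g + 1) + n →
    W (g + 1) n v = ∑ a, ∑ b, W g (n + 2) (Fin.append v ![e a, e b]) * F.etaInv e a b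
  glue_pair : ∀ (g₁ g₂ m n : ℕ) [NeZero (m + n)] (r : ℕ) (e : Module.Basis (Fin r) K A)
    (v : Fin m → A) (w : Fin n → A), 2 < 2 * g₁ + (m + 1) → 2 < 2 * g₂ + (n + 1) →
    W (g₁ + g₂) (m + n) (Fin.append v w) =
      ∑ a, ∑ b, F.etaInv e a b *
        (W g₁ (m + 1) (Fin.snoc v (e a)) * W g₂ (n + 1) (Fin.snoc w (e b)))

/-! Contracting edges reduces any connected cell graph to points, and every contraction is visible
both in the genus and in the value of the functor. The core, `ECOFunctor.exists_genus_val_eq`, is a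
strong induction on the number of half-edges proving both at once: the Euler characteristic is `2 -
2g` with `g` a natural number, and the value is `ε(∏ v · e^g)`. Hence the value depends only on the
type `(g,n)`, whichever edges are contracted.

An edge between distinct vertices is contracted by ECO 1, which keeps the genus and replaces two
entries by their product. If there is no such edge, connectedness leaves one vertex. Without loops
this is the sphere with value `ε`. Otherwise ECO 2 at a loop gives two vertices and raises the Euler
characteristic by 2. If they lie in different components, of genera `g₁` and `g₂`, then `g = g₁ +
g₂`, and pairing `δ(v)` with the two values gives `ε(v e^{g₁} e^{g₂})` (`lift_comul`). If they are
still connected, in genus `g'`, then `g = g' + 1`, and `m(δ(v)) = v e` supplies one more factor `e`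
(`lift_comul'`).

The topology is thus carried by two changes of Euler characteristic, `eulerChar_contractEdge` and
`eulerChar_contractLoop`, which come down to counting cycles of `p * swap h k` and of permutations
with points skipped. The algebra is carried by the completeness relation `sum_etaInv`, which yields
the formula for `δ` and both gluing axioms. Finally, `Γ_{g,n}` is non-empty because of an explicit
one-vertex graph of genus `g`, to which pendant edges are attached. -/

namespace CellPerm

open Equiv Equiv.Perm

/-! ### Counting the cycles of a permutation -/

variable {α : Type*}

/-- The number of cycles of a permutation, fixed points included. -/
noncomputable def numCycles (p : Perm α) : ℕ :=
  Nat.card (Quotient (SameCycle.setoid p))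

theorem numCycles_eq_card {p : Perm α} (hp : ∀ x, p x = x) : numCycles p = Nat.card α := by
  refine (Nat.card_eq_of_bijective (Quotient.mk (SameCycle.setoid p))
    ⟨fun x y hxy => ?_, Quotient.mk_surjective⟩).symm
  exact sameCycle_le (R := Eq) eq_equivalence (fun x => (hp x).symm) (Quotient.exact hxy)

theorem numCycles_eq_add_subtype [Finite α] (p : Perm α) {P : α → Prop}
    (hP : ∀ x, P (p x) ↔ P x) (hP' : ∀ x, ¬ P (p x) ↔ ¬ P x) :
    numCycles p = numCycles (p.subtypePerm hP) + numCycles (p.subtypePerm (p := fun x => ¬ P x) hP') := by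
  have hc : ∀ {x y}, p.SameCycle x y → (P x ↔ P y) := fun h =>
    sameCycle_le (R := fun x y => (P x ↔ P y))
      ⟨fun _ => Iff.rfl, fun h => h.symm, fun h h' => h.trans h'⟩ (fun x => (hP x).symm) h
  unfold numCycles
  rw [← Nat.card_sum]
  let f : Quotient (SameCycle.setoid (p.subtypePerm hP)) → Quotient (SameCycle.setoid p) :=
    Quotient.map Subtype.val fun x y (h : SameCycle _ x y) => (sameCycle_subtypePerm.1 h :)
  let f' : Quotient (SameCycle.setoid (p.subtypePerm (p := fun x => ¬ P x) hP')) → Quotient (SameCycle.setoid p) :=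
    Quotient.map Subtype.val fun x y (h : SameCycle _ x y) => (sameCycle_subtypePerm.1 h :)
  refine (Nat.card_eq_of_bijective (Sum.elim f f') ⟨?_, ?_⟩).symm
  · rintro (x | x) (y | y) <;> induction x using Quotient.inductionOn with | _ x => ?_ <;>
      induction y using Quotient.inductionOn with | _ y => ?_ <;> intro h <;>
      have h' : p.SameCycle x y := Quotient.exact h
    · exact congrArg Sum.inl (Quotient.sound (sameCycle_subtypePerm.2 h' :))
    · exact (y.2 ((hc h').1 x.2)).elim
    · exact (x.2 ((hc h').2 y.2)).elim
    · exact congrArg Sum.inr (Quotient.sound (sameCycle_subtypePerm.2 h' :))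
  · intro x
    induction x using Quotient.inductionOn with | _ x => ?_
    by_cases hx : P x
    · exact ⟨Sum.inl (Quotient.mk _ ⟨x, hx⟩), rfl⟩
    · exact ⟨Sum.inr (Quotient.mk _ ⟨x, hx⟩), rfl⟩

theorem numCycles_sumCongr {β : Type*} [Finite α] [Finite β] (p : Perm α) (q : Perm β) :
    numCycles (Perm.sumCongr p q) = numCycles p + numCycles q := by
  have hl : ∀ {x y : α}, p.SameCycle x y → (Perm.sumCongr p q).SameCycle (Sum.inl x) (Sum.inl y) :=
    sameCycle_le ((SameCycle.equivalence _).comap Sum.inl) fun x =>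
      sameCycle_apply_right.2 (SameCycle.refl _ _)
  have hr : ∀ {x y : β}, q.SameCycle x y → (Perm.sumCongr p q).SameCycle (Sum.inr x) (Sum.inr y) :=
    sameCycle_le ((SameCycle.equivalence _).comap Sum.inr) fun x =>
      sameCycle_apply_right.2 (SameCycle.refl _ _)
  have hc : ∀ {x y}, (Perm.sumCongr p q).SameCycle x y → Sum.LiftRel p.SameCycle q.SameCycle x y := by
    refine sameCycle_le ⟨?_, ?_, ?_⟩ ?_
    · rintro (x | x)
      exacts [.inl (SameCycle.refl _ _), .inr (SameCycle.refl _ _)]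
    · rintro _ _ (h | h)
      exacts [.inl h.symm, .inr h.symm]
    · rintro _ _ _ (h | h) (h' | h')
      exacts [.inl (h.trans h'), .inr (h.trans h')]
    · rintro (x | x)
      exacts [.inl (sameCycle_apply_right.2 (SameCycle.refl _ _)),
        .inr (sameCycle_apply_right.2 (SameCycle.refl _ _))]
  unfold numCycles
  rw [← Nat.card_sum]
  refine (Nat.card_eq_of_bijective (Sum.elim
    (Quotient.map (sa := SameCycle.setoid p) (sb := SameCycle.setoid (Perm.sumCongr p q))
      Sum.inl fun _ _ h => hl h)
    (Quotient.map (sa := SameCycle.setoid q) (sb := SameCycle.setoid (Perm.sumCongr p q))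
      Sum.inr fun _ _ h => hr h)) ⟨?_, ?_⟩).symm
  · rintro (x | x) (y | y) <;> induction x using Quotient.inductionOn with | _ x => ?_ <;>
      induction y using Quotient.inductionOn with | _ y => ?_ <;> intro h <;>
      cases hc (Quotient.exact h)
    · exact congrArg Sum.inl (Quotient.sound ‹_›)
    · exact congrArg Sum.inr (Quotient.sound ‹_›)
  · intro x
    induction x using Quotient.inductionOn with | _ x => ?_
    rcases x with x | x
    exacts [⟨Sum.inl (Quotient.mk _ x), rfl⟩, ⟨Sum.inr (Quotient.mk _ x), rfl⟩]

theorem not_sameCycle_sumCongr {β : Type*} (p : Perm α) (q : Perm β) (x : α) (y : β) :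
    ¬ (Perm.sumCongr p q).SameCycle (Sum.inl x) (Sum.inr y) := fun h => by
  have := sameCycle_le (R := fun x y => x.isLeft = y.isLeft) (eq_equivalence.comap Sum.isLeft)
    (by rintro (x | x) <;> rfl) h
  simp at this

/-- Cycles of `cut p h k` refine those of `p`, and only the cycle through `h` and `k` is divided,
into the part of `h` and the part of `k`. Leaving out the part of `h` therefore gives a bijection
with the cycles of `p`, in which the part of `k` stands for the divided cycle. -/
theorem numCycles_cut_of_sameCycle [Finite α] (p : Perm α) {h k : α} (hne : h ≠ k)
    (hp : p.SameCycle h k) : numCycles (cut p h k) = numCycles p + 1 := by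
  classical
  have hA : ∀ {x y}, (cut p h k).SameCycle x y → p.SameCycle x y := by
    intro x y hxy
    have := sameCycle_cut_or (cut p h k) h k hxy
    rw [cut_cut] at this
    rcases this with h1 | ⟨h1, h2⟩
    · exact h1
    · exact (h1.elim (fun h => h.trans hp) id).trans (h2.elim (fun h => h.trans hp) id).symm
  have hC := not_sameCycle_cut p hne hp
  unfold numCycles
  rw [← Nat.card_congr (Equiv.optionSubtypeNe
    (Quotient.mk (SameCycle.setoid (cut p h k)) h)), Finite.card_option]
  congr 1
  refine Nat.card_eq_of_bijective (fun c => Quotient.map (sa := SameCycle.setoid (cut p h k))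
    (sb := SameCycle.setoid p) id (fun _ _ h => hA h) c.1) ⟨?_, ?_⟩
  · rintro ⟨x, hx⟩ ⟨y, hy⟩ hxy
    induction x using Quotient.inductionOn with | _ x => ?_
    induction y using Quotient.inductionOn with | _ y => ?_
    have hx' : ¬ (cut p h k).SameCycle x h := fun h' => hx (Quotient.sound h')
    have hy' : ¬ (cut p h k).SameCycle y h := fun h' => hy (Quotient.sound h')
    refine Subtype.ext (Quotient.sound ?_)
    rcases sameCycle_cut_or p h k (Quotient.exact hxy) with h1 | ⟨h1, h2⟩
    · exact h1
    · exact SameCycle.trans (h1.resolve_left hx') (h2.resolve_left hy').symm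
  · intro x
    induction x using Quotient.inductionOn with | _ x => ?_
    by_cases hx : (cut p h k).SameCycle x h
    · exact ⟨⟨Quotient.mk _ k, fun h' => hC (Quotient.exact h')⟩,
        Quotient.sound ((hA hx).trans hp).symm⟩
    · exact ⟨⟨Quotient.mk _ x, fun h' => hx (Quotient.exact h')⟩, rfl⟩

/-- Cutting twice at the same points restores `p`, and the first cut has joined the two cycles, so
this is the previous count read backwards. -/
theorem numCycles_cut_of_not_sameCycle [Finite α] (p : Perm α) {h k : α}
    (hp : ¬ p.SameCycle h k) : numCycles (cut p h k) + 1 = numCycles p := by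
  have hne : h ≠ k := fun e => hp (e ▸ SameCycle.refl _ _)
  rw [← numCycles_cut_of_sameCycle _ hne (sameCycle_cut p hp), cut_cut]

-- Skipping `a` splits it off as a fixed point, which is a new cycle unless `a` was fixed already:
-- unless `p a = a`, it is the cut of `p` at `p⁻¹ a` and `a`.
open Classical in
theorem numCycles_skip [Finite α] (p : Perm α) (a : α) :
    numCycles (skip p a) + (if p a = a then 1 else 0) = numCycles p + 1 := by
  split_ifs with h
  · rw [skip, h, swap_self]; rfl
  · have : skip p a = cut p (p.symm a) a := by
      simp only [skip, cut, mul_swap_eq_swap_mul, Equiv.apply_symm_apply]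
    rw [this, numCycles_cut_of_sameCycle, add_zero]
    · exact fun e => h (by rw [Equiv.symm_apply_eq] at e; exact e.symm)
    · rw [sameCycle_symm_apply_left]

-- The two conditional terms count the cycles of `p` contained in `{a, b}`, which disappear with
-- these points; the second one asks whether `skip p a` fixes `b`. They involve only `p a` and `p
-- b`, so permutations agreeing at `a` and `b` lose equally many cycles.
open Classical in
theorem numCycles_skip_skip [Finite α] (p : Perm α) {a b : α} (hab : a ≠ b)
    (hP : ∀ x, (skip (skip p a) b x ≠ a ∧ skip (skip p a) b x ≠ b) ↔ (x ≠ a ∧ x ≠ b)) :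
    numCycles ((skip (skip p a) b).subtypePerm (p := fun x => x ≠ a ∧ x ≠ b) hP) + (if p a = a then 1 else 0) +
      (if swap a (p a) (p b) = b then 1 else 0) = numCycles p := by
  have h1 := numCycles_skip p a
  have h2 := numCycles_skip (skip p a) b
  have h3 := numCycles_eq_add_subtype (P := fun x => x ≠ a ∧ x ≠ b) (skip (skip p a) b) hP fun x => not_congr (hP x)
  -- The discarded part consists of the two fixed points `a` and `b`.
  have h4 : numCycles ((skip (skip p a) b).subtypePerm
      (p := fun x => ¬ (x ≠ a ∧ x ≠ b)) fun x => not_congr (hP x)) = 2 := by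
    rw [numCycles_eq_card]
    · have : {x | ¬ (x ≠ a ∧ x ≠ b)} = {a, b} := by
        ext x
        simp only [Set.mem_ofPred_eq, Set.mem_insert_iff, Set.mem_singleton_iff]
        tauto
      rw [← Set.ncard_pair hab, ← this]
      rfl
    · rintro ⟨x, hx⟩
      have : x = a ∨ x = b := by tauto
      apply Subtype.ext
      change skip (skip p a) b x = x
      rcases this with rfl | rfl
      · have : skip p x x ≠ b := by rwa [skip_self]
        rw [skip_of_ne hab this, skip_self]
      · exact skip_self _ _
  have h5 : skip p a b = swap a (p a) (p b) := by simp [skip]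
  rw [h5] at h2
  omega

end CellPerm

/-! ### Euler characteristic and connectedness under edge contraction -/

namespace CellGraph

open CellPerm Equiv Equiv.Perm

variable {V : Type}

theorem card_vertices [Finite V] (γ : CellGraph V) :
    Nat.card V = numCycles γ.rot + Nat.card {v : V // ∀ h, γ.vert h ≠ v} := by
  unfold numCycles
  rw [← Nat.card_sum]
  refine (Nat.card_eq_of_bijective (Sum.elim
    (Quotient.lift (s := SameCycle.setoid γ.rot) γ.vert fun x y h => (γ.vert_eq_iff x y).2 h)
    Subtype.val) ⟨?_, ?_⟩).symm
  · rintro (x | x) (y | y) h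
    · induction x using Quotient.inductionOn with | _ x => ?_
      induction y using Quotient.inductionOn with | _ y => ?_
      exact congrArg Sum.inl (Quotient.sound ((γ.vert_eq_iff x y).1 h))
    · induction x using Quotient.inductionOn with | _ x => ?_
      exact (y.2 x h).elim
    · induction y using Quotient.inductionOn with | _ y => ?_
      exact (x.2 y h.symm).elim
    · exact congrArg Sum.inr (Subtype.ext h)
  · intro v
    by_cases hv : ∀ h, γ.vert h ≠ v
    · exact ⟨Sum.inr ⟨v, hv⟩, rfl⟩
    · push Not at hv
      obtain ⟨h, rfl⟩ := hv
      exact ⟨Sum.inl (Quotient.mk _ h), rfl⟩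

/-- The Euler characteristic in terms of the rotation system alone. -/
theorem eulerChar_eq [Finite V] (γ : CellGraph V) :
    γ.eulerChar = 2 * (Nat.card V : ℤ) - numCycles γ.rot - numCycles γ.inv +
      numCycles (γ.rot * γ.inv) := by
  -- The isolated vertices, which enter the count of faces, number `|V|` minus the cycles of `rot`;
  -- this is where the coefficient 2 of `|V|` comes from.
  have h1 := γ.card_vertices
  have h2 : γ.numEdges = numCycles γ.inv := rfl
  have h3 : γ.numFaces = numCycles (γ.rot * γ.inv) +
    Nat.card {v : V // ∀ h, γ.vert h ≠ v} := rfl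
  rw [eulerChar, h2, h3]
  push_cast
  omega

theorem eulerChar_of_isEmpty [Unique V] (γ : CellGraph V) [IsEmpty γ.H] : γ.eulerChar = 2 := by
  rw [eulerChar_eq]
  simp [numCycles_eq_card (α := γ.H) (fun x => isEmptyElim x)]

theorem eulerChar_restrict [Finite V] (γ : CellGraph V) (S : Set V)
    (hS : ∀ h : γ.H, γ.vert (γ.inv h) ∈ S ↔ γ.vert h ∈ S) :
    γ.eulerChar = (γ.restrict S hS).eulerChar +
      (γ.restrict Sᶜ fun h => not_congr (hS h)).eulerChar := by
  have hr : ∀ h : γ.H, γ.vert (γ.rot h) ∈ S ↔ γ.vert h ∈ S := fun h => by rw [γ.vert_rot]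
  have hf : ∀ h : γ.H, γ.vert ((γ.rot * γ.inv) h) ∈ S ↔ γ.vert h ∈ S := fun h =>
    (hr _).trans (hS h)
  have h1 := numCycles_eq_add_subtype (P := fun h => γ.vert h ∈ S) γ.rot hr
    fun h => not_congr (hr h)
  have h2 := numCycles_eq_add_subtype (P := fun h => γ.vert h ∈ S) γ.inv hS
    fun h => not_congr (hS h)
  have h3 := numCycles_eq_add_subtype (P := fun h => γ.vert h ∈ S) (γ.rot * γ.inv) hf
    fun h => not_congr (hf h)
  have h4 : Nat.card V = Nat.card S + Nat.card (Sᶜ : Set V) := by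
    classical
    rw [← Nat.card_sum, Nat.card_congr (Equiv.Set.sumCompl S)]
  rw [eulerChar_eq, eulerChar_eq, eulerChar_eq, h1, h2, h3, h4]
  change _ = 2 * ((Nat.card S : ℕ) : ℤ) - numCycles (γ.rot.subtypePerm hr) -
    numCycles (γ.inv.subtypePerm hS) + numCycles ((γ.rot * γ.inv).subtypePerm hf) +
    (2 * ((Nat.card (Sᶜ : Set V) : ℕ) : ℤ) -
      numCycles (γ.rot.subtypePerm (p := fun h => ¬ γ.vert h ∈ S) fun h => not_congr (hr h)) -
      numCycles (γ.inv.subtypePerm (p := fun h => ¬ γ.vert h ∈ S) fun h => not_congr (hS h)) +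
      numCycles ((γ.rot * γ.inv).subtypePerm (p := fun h => ¬ γ.vert h ∈ S)
        fun h => not_congr (hf h)))
  push_cast
  ring

theorem numCycles_contractInv (γ : CellGraph V) (h : γ.H) :
    numCycles (γ.contractInv h) + 1 = numCycles γ.inv := by
  classical
  have hP : ∀ x, (skip (skip γ.inv h) (γ.inv h) x ≠ h ∧
      skip (skip γ.inv h) (γ.inv h) x ≠ γ.inv h) ↔ (x ≠ h ∧ x ≠ γ.inv h) := by
    have e : ∀ x, skip (skip γ.inv h) (γ.inv h) x = swap h (γ.inv h) (γ.inv x) := fun x => by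
      simp [skip, γ.inv_inv]
    intro x
    rw [e, Ne, Ne, swap_apply_eq_iff, swap_apply_eq_iff, swap_apply_left, swap_apply_right,
      Equiv.apply_eq_iff_eq, ← γ.inv_inv h, Equiv.apply_eq_iff_eq, γ.inv_inv]
  have h1 := numCycles_skip_skip γ.inv (γ.inv_ne h).symm hP
  have h2 : (skip (skip γ.inv h) (γ.inv h)).subtypePerm hP = γ.contractInv h := by
    ext x
    have hx1 : γ.inv x ≠ h := fun e =>
      x.2.2 ((γ.inv_inv _).symm.trans (congrArg γ.inv e))
    have hx2 : γ.inv x ≠ γ.inv h := fun e => x.2.1 (γ.inv.injective e)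
    change skip (skip γ.inv h) (γ.inv h) x = γ.inv x
    have : skip γ.inv h x = γ.inv x := skip_of_ne x.2.1 hx1
    rw [skip_of_ne x.2.2 (by rwa [this]), this]
  -- Exactly one cycle is lost, the 2-cycle of `h` and `inv h`: `h` is not fixed, but `inv h`
  -- becomes fixed once `h` is skipped.
  rw [h2, if_neg (γ.inv_ne h), γ.inv_inv, swap_apply_left, if_pos rfl] at h1
  exact h1

/-- Contraction of an edge removes the cycles on the two halves of the edge, and these are the same
for the faces as for the new vertices. -/
theorem numCycles_contractRot_mul (γ : CellGraph V) (h : γ.H) :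
    numCycles (γ.contractRot h * γ.contractInv h) + numCycles (γ.cutRot h) =
      numCycles (γ.rot * γ.inv) + numCycles (γ.contractRot h) := by
  classical
  set k := γ.inv h with hk
  -- The face permutation and `cutRot` agree at `h` and `k`, so the correction terms of
  -- `numCycles_skip_skip` coincide for the two and cancel.
  have hl : γ.cutRot h h = (γ.rot * γ.inv) h := by rw [cutRot, cut_left, Perm.mul_apply]
  have hr : γ.cutRot h k = (γ.rot * γ.inv) k := by
    rw [cutRot, cut_right, Perm.mul_apply, hk, γ.inv_inv]
  have hskip : ∀ (p : Perm γ.H) x, skip (skip p h) k x =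
      swap k (swap h (p h) (p k)) (swap h (p h) (p x)) := fun p x => by simp [skip]
  have hx : ∀ x, x ≠ h ∧ x ≠ k →
      skip (skip (γ.cutRot h) h) k (γ.inv x) = skip (skip (γ.rot * γ.inv) h) k x := by
    rintro x ⟨h1, h2⟩
    have h3 : γ.inv x ≠ h := fun e => h2 (by rw [hk, ← e, γ.inv_inv])
    have h4 : γ.inv x ≠ k := fun e => h1 (γ.inv.injective e)
    have h5 : γ.cutRot h (γ.inv x) = (γ.rot * γ.inv) x := cut_of_ne _ h3 h4
    rw [hskip, hskip, hl, hr, h5]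
  have hself : ∀ (p : Perm γ.H), skip (skip p h) k h = h ∧ skip (skip p h) k k = k := fun p => by
    refine ⟨?_, skip_self _ _⟩
    have : skip p h h ≠ k := by rw [skip_self]; exact (γ.inv_ne h).symm
    rw [skip_of_ne (γ.inv_ne h).symm this, skip_self]
  have hP : ∀ x, (skip (skip (γ.rot * γ.inv) h) k x ≠ h ∧
      skip (skip (γ.rot * γ.inv) h) k x ≠ k) ↔ (x ≠ h ∧ x ≠ k) := fun x => by
    obtain ⟨h1, h2⟩ := hself (γ.rot * γ.inv)
    refine and_congr (not_congr ?_) (not_congr ?_)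
    · exact ⟨fun e => Equiv.injective _ (e.trans h1.symm), fun e => by rw [e]; exact h1⟩
    · exact ⟨fun e => Equiv.injective _ (e.trans h2.symm), fun e => by rw [e]; exact h2⟩
  have e1 := numCycles_skip_skip (b := k) (γ.rot * γ.inv) (γ.inv_ne h).symm hP
  have e2 := numCycles_skip_skip (b := k) (γ.cutRot h) (γ.inv_ne h).symm (γ.skip_skip_mem h)
  -- The faces of the contracted graph are the old faces with the two half-edges skipped.
  have e3 : γ.contractRot h * γ.contractInv h =
      (skip (skip (γ.rot * γ.inv) h) k).subtypePerm hP := by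
    ext x
    exact hx x x.2
  have e4 : γ.contractRot h = (skip (skip (γ.cutRot h) h) k).subtypePerm (γ.skip_skip_mem h) := rfl
  rw [e3, e4]
  rw [hl, hr] at e2
  omega

/-- One vertex and one edge are lost, and the cut joins two cycles of `rot`. -/
theorem eulerChar_contractEdge [Finite V] (γ : CellGraph V) (h : γ.H)
    (hne : γ.vert h ≠ γ.vert (γ.inv h)) : (γ.contractEdge h hne).eulerChar = γ.eulerChar := by
  classical
  rw [eulerChar_eq, eulerChar_eq]
  change 2 * (Nat.card {v : V // v ≠ γ.vert (γ.inv h)} : ℤ) - numCycles (γ.contractRot h) -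
    numCycles (γ.contractInv h) + numCycles (γ.contractRot h * γ.contractInv h) = _
  have h1 := γ.numCycles_contractInv h
  have h2 := γ.numCycles_contractRot_mul h
  have h3 : numCycles (γ.cutRot h) + 1 = numCycles γ.rot :=
    numCycles_cut_of_not_sameCycle _ (by rwa [← γ.vert_eq_iff])
  have h4 : Nat.card V = Nat.card {v : V // v ≠ γ.vert (γ.inv h)} + 1 := by
    rw [← Finite.card_option]
    exact Nat.card_congr (Equiv.optionSubtypeNe _).symm
  omega

/-- A vertex is gained and an edge lost, while the cut divides a cycle of `rot`. Topologically, the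
surface is cut along the loop and the two boundary circles are capped by discs. -/
theorem eulerChar_contractLoop [Finite V] (γ : CellGraph V) (h : γ.H)
    (hl : γ.vert h = γ.vert (γ.inv h)) : (γ.contractLoop h hl).eulerChar = γ.eulerChar + 2 := by
  rw [eulerChar_eq, eulerChar_eq]
  change 2 * (Nat.card (Option V) : ℤ) - numCycles (γ.contractRot h) -
    numCycles (γ.contractInv h) + numCycles (γ.contractRot h * γ.contractInv h) = _
  have h1 := γ.numCycles_contractInv h
  have h2 := γ.numCycles_contractRot_mul h
  have h3 : numCycles (γ.cutRot h) = numCycles γ.rot + 1 :=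
    numCycles_cut_of_sameCycle _ (γ.inv_ne h).symm ((γ.vert_eq_iff _ _).1 hl)
  have h4 : Nat.card (Option V) = Nat.card V + 1 := Finite.card_option
  omega

theorem connected_contractEdge {γ : CellGraph V} (hγ : γ.Connected) (h : γ.H)
    (hne : γ.vert h ≠ γ.vert (γ.inv h)) : (γ.contractEdge h hne).Connected := by
  classical
  -- The quotient map identifying the two ends of the edge; paths are pushed forward along it.
  let f : V → {v : V // v ≠ γ.vert (γ.inv h)} := fun v =>
    if hv : v = γ.vert (γ.inv h) then ⟨γ.vert h, hne⟩ else ⟨v, hv⟩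
  have hf : ∀ u v, γ.Adj u v → Relation.ReflTransGen (γ.contractEdge h hne).Adj (f u) (f v) := by
    rintro _ _ ⟨x, rfl, rfl⟩
    have hfe : f (γ.vert h) = f (γ.vert (γ.inv h)) := by simp [f, hne]
    by_cases h1 : x = h
    · rw [h1, hfe]
    · by_cases h2 : x = γ.inv h
      · rw [h2, γ.inv_inv, hfe]
      · exact .single ⟨⟨x, h1, h2⟩, rfl, rfl⟩
  refine ⟨⟨⟨γ.vert h, hne⟩⟩, ?_⟩
  rintro ⟨u, hu⟩ ⟨v, hv⟩
  have : ∀ {a b}, Relation.ReflTransGen γ.Adj a b →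
      Relation.ReflTransGen (γ.contractEdge h hne).Adj (f a) (f b) := fun hab => by
    induction hab with
    | refl => exact .refl
    | tail _ h1 ih => exact ih.trans (hf _ _ h1)
  have := this (hγ.2 u v)
  simpa only [f, dif_neg hu, dif_neg hv] using this

theorem connected_of_subsingleton [Nonempty V] [Subsingleton V] (γ : CellGraph V) :
    γ.Connected :=
  ⟨inferInstance, fun u v => Subsingleton.elim u v ▸ .refl⟩

theorem subsingleton_of_forall_loop {γ : CellGraph V} (hγ : γ.Connected)
    (hl : ∀ h, γ.vert h = γ.vert (γ.inv h)) : Subsingleton V := by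
  refine ⟨fun u v => ?_⟩
  induction hγ.2 u v with
  | refl => rfl
  | tail _ h1 ih =>
    obtain ⟨x, rfl, rfl⟩ := h1
    rw [ih, hl]

end CellGraph

/-! ### Comultiplication, Euler element and the field theory of a Frobenius algebra -/

namespace FrobeniusStructure

variable {K A : Type*} [Field K] [CommRing A] [Algebra K A] (F : FrobeniusStructure K A)

theorem counit_ne_zero [Nontrivial A] : F.counit ≠ 0 := fun h =>
  one_ne_zero (F.nondeg 1 fun x => by rw [h, LinearMap.zero_apply])

/-- Completeness relation: the inverse Gram matrix recovers the coordinates of `y` from the numbers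
`ε(y e_b)`, and `ε(x ·)` is linear. -/
theorem sum_etaInv {r : ℕ} (e : Module.Basis (Fin r) K A) (x y : A) :
    ∑ a, ∑ b, F.etaInv e a b * (F.counit (x * e a) * F.counit (y * e b)) =
      F.counit (x * y) := by
  set M : Matrix (Fin r) (Fin r) K := Matrix.of fun i j => F.eta (e i) (e j) with hM
  have hMe : M = LinearMap.BilinForm.toMatrix e F.eta := by
    ext i j
    simp [hM, LinearMap.BilinForm.toMatrix_apply]
  have hdet : IsUnit M.det := by
    rw [hMe, isUnit_iff_ne_zero, ← LinearMap.BilinForm.nondegenerate_iff_det_ne_zero]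
    exact F.eta_nondegenerate
  have hy : ∀ y b, F.counit (y * e b) = (M.mulVec (e.repr y)) b := by
    intro y b
    conv_lhs => rw [← e.sum_repr y]
    simp only [Finset.mul_sum, map_sum, mul_smul_comm, map_smul, smul_eq_mul, Matrix.mulVec,
      dotProduct, hM, Matrix.of_apply, eta_apply, mul_comm]
  have hxy : F.counit (x * y) = ∑ a, F.counit (x * e a) * e.repr y a := by
    conv_lhs => rw [← e.sum_repr y]
    simp only [Finset.mul_sum, map_sum, mul_smul_comm, map_smul, smul_eq_mul, mul_comm]
  have hinv : ∀ a, ∑ b, F.etaInv e a b * F.counit (y * e b) = e.repr y a := by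
    intro a
    simp only [hy]
    change (M⁻¹.mulVec (M.mulVec (e.repr y))) a = _
    rw [Matrix.mulVec_mulVec, Matrix.nonsing_inv_mul _ hdet, Matrix.one_mulVec]
  rw [hxy]
  refine Finset.sum_congr rfl fun a _ => ?_
  rw [← hinv, Finset.mul_sum]
  exact Finset.sum_congr rfl fun b _ => by ring

variable [FiniteDimensional K A]

theorem lam_apply (u v : A) : F.lam u v = F.counit (u * v) := by
  rw [lam, LinearMap.BilinForm.toDual_def, eta_apply]

/-- Under the injective map `λ ⊗ λ` both sides become the functional `x ⊗ y ↦ ε(uxy)`, on the right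
by the completeness relation. -/
theorem comul_eq_sum {r : ℕ} (e : Module.Basis (Fin r) K A) (u : A) :
    F.comul u = ∑ a, ∑ b, F.etaInv e a b • ((u * e a) ⊗ₜ[K] e b) := by
  have hinj := ((TensorProduct.dualDistribEquiv K A A).injective.comp
    (TensorProduct.congr F.lam F.lam).injective)
  apply hinj
  apply TensorProduct.ext'
  intro x y
  have h1 := F.sum_etaInv e (u * x) y
  simp only [Function.comp_apply, comul, LinearMap.comp_apply, LinearEquiv.coe_coe,
    LinearEquiv.apply_symm_apply, LinearMap.dualMap_apply, LinearMap.mul'_apply, lam_apply,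
    map_sum, map_smul, TensorProduct.congr_tmul, LinearMap.sum_apply, LinearMap.smul_apply,
    TensorProduct.dualDistribEquiv, TensorProduct.dualDistribEquivOfBasis_apply_apply,
    TensorProduct.homTensorHomMap_apply, TensorProduct.map_tmul, TensorProduct.lid_tmul, smul_eq_mul]
  rw [← mul_assoc, ← h1]
  refine Finset.sum_congr rfl fun a _ => Finset.sum_congr rfl fun b _ => ?_
  rw [mul_right_comm u x, mul_comm y]

theorem euler_eq_sum {r : ℕ} (e : Module.Basis (Fin r) K A) :
    F.euler = ∑ a, ∑ b, F.etaInv e a b • (e a * e b) := by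
  simp [euler, F.comul_eq_sum e]

theorem mul'_comul (u : A) : LinearMap.mul' K A (F.comul u) = u * F.euler := by
  rw [F.comul_eq_sum (Module.finBasis K A), F.euler_eq_sum (Module.finBasis K A)]
  simp [Finset.mul_sum, mul_assoc]

/-- Evaluation of the two factors of `δ(u)` against `ε(· x)` and `ε(· y)`. -/
theorem lift_comul (u x y : A) (f : A →ₗ[K] A →ₗ[K] K)
    (hf : ∀ a b, f a b = F.counit (a * x) * F.counit (b * y)) :
    TensorProduct.lift f (F.comul u) = F.counit (u * x * y) := by
  rw [F.comul_eq_sum (Module.finBasis K A), ← F.sum_etaInv (Module.finBasis K A) (u * x) y]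
  simp only [map_sum, map_smul, TensorProduct.lift.tmul, hf, smul_eq_mul]
  refine Finset.sum_congr rfl fun a _ => Finset.sum_congr rfl fun b _ => ?_
  rw [mul_right_comm u x, mul_comm y]

/-- Evaluation of the product of the two factors of `δ(u)` against `ε(· x)`. -/
theorem lift_comul' (u x : A) (f : A →ₗ[K] A →ₗ[K] K)
    (hf : ∀ a b, f a b = F.counit (a * b * x)) :
    TensorProduct.lift f (F.comul u) = F.counit (u * (F.euler * x)) := by
  have : TensorProduct.lift f =
      F.counit ∘ₗ (LinearMap.mulRight K x) ∘ₗ LinearMap.mul' K A := by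
    ext a b
    simp [hf]
  rw [this, LinearMap.comp_apply, LinearMap.comp_apply, mul'_comul, LinearMap.mulRight_apply,
    mul_assoc]

/-- The maps `(v₁,…,vₙ) ↦ ε(v₁⋯vₙ e^g)`. -/
noncomputable def omega (g n : ℕ) : MultilinearMap K (fun _ : Fin n => A) K :=
  (F.counit ∘ₗ LinearMap.mulRight K (F.euler ^ g)).compMultilinearMap
    (MultilinearMap.mkPiAlgebra K (Fin n) A)

theorem omega_apply (g n : ℕ) (v : Fin n → A) :
    F.omega g n v = F.counit ((∏ i, v i) * F.euler ^ g) := by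
  simp [omega]

theorem isTQFT_omega [Nontrivial A] : IsTQFT F fun g n _ => F.omega g n where
  counit_ne_zero := F.counit_ne_zero
  zero_one v := by simp [omega_apply]
  zero_two v := by simp [omega_apply, eta_apply, Fin.prod_univ_two]
  symm g n _ _ s v := by
    simp only [omega_apply, Function.comp_apply, Equiv.prod_comp s v]
  zero_three v := by simp [omega_apply, eta_apply, Fin.prod_univ_three]
  unit g n _ _ v := by simp [omega_apply, Fin.prod_univ_castSucc]
  -- One factor `e` of `e^(g+1)` is expanded as `∑ η^{ab} e_a e_b`.
  glue_self g n _ r e v _ := by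
    simp only [omega_apply, Fin.prod_univ_add, Fin.append_left, Fin.append_right,
      Fin.prod_univ_two, Matrix.cons_val_zero, Matrix.cons_val_one]
    rw [pow_succ']
    have : (∏ i, v i) * (F.euler * F.euler ^ g) =
        ∑ a, ∑ b, F.etaInv e a b • ((∏ i, v i) * (e a * e b) * F.euler ^ g) := by
      conv_lhs => enter [2, 1]; rw [F.euler_eq_sum e]
      simp only [Finset.mul_sum, Finset.sum_mul, smul_mul_assoc, mul_smul_comm, mul_assoc]
    rw [this]
    simp only [map_sum, map_smul, smul_eq_mul, mul_comm]
  -- The completeness relation for `x = ∏ v · e^{g₁}` and `y = ∏ w · e^{g₂}`.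
  glue_pair g₁ g₂ m n _ r e v w _ _ := by
    simp only [omega_apply, Fin.prod_univ_add, Fin.append_left, Fin.append_right,
      Fin.prod_univ_castSucc, Fin.snoc_castSucc, Fin.snoc_last]
    have := F.sum_etaInv e ((∏ i, v i) * F.euler ^ g₁) ((∏ i, w i) * F.euler ^ g₂)
    rw [pow_add, mul_mul_mul_comm, ← this]
    simp only [mul_right_comm]

end FrobeniusStructure

/-! ### Evaluation of an ECO functor by induction on half-edges -/

namespace ECOFunctor

open CellGraph

variable {K A : Type*} [Field K] [CommRing A] [Algebra K A] [FiniteDimensional K A]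
  {F : FrobeniusStructure K A}

/-- The genus of a connected cell graph is a natural number, and it determines the value of an
ECO functor. -/
theorem exists_genus_val_eq (ω : ECOFunctor F) (N : ℕ) :
    ∀ {V : Type} [Fintype V] (γ : CellGraph V), Nat.card γ.H = N → γ.Connected →
      ∃ g : ℕ, γ.eulerChar = 2 - 2 * (g : ℤ) ∧
        ∀ v : V → A, ω.val γ v = F.counit ((∏ u, v u) * F.euler ^ g) := by
  classical
  induction N using Nat.strong_induction_on with | _ N ih => ?_
  intro V _ γ hN hγ
  have hlt : ∀ h : γ.H, Nat.card (γ.Rest h) < N := fun h =>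
    hN ▸ Finite.card_subtype_lt (x := h) (fun e => e.1 rfl)
  by_cases hloop : ∀ h, γ.vert h = γ.vert (γ.inv h)
  · have hV := subsingleton_of_forall_loop hγ hloop
    rcases isEmpty_or_nonempty γ.H with hH | ⟨⟨h⟩⟩
    · let _ : Unique V := @Unique.mk' V (Classical.inhabited_of_nonempty hγ.1) hV
      refine ⟨0, by simp [eulerChar_of_isEmpty], fun v => ?_⟩
      rw [ω.val_point, Fintype.prod_unique, pow_zero, mul_one]
    · set i := γ.vert h with hi
      have hl := hloop h
      set γ' := γ.contractLoop h hl with hγ'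
      have hχ : γ'.eulerChar = γ.eulerChar + 2 := γ.eulerChar_contractLoop h hl
      have hprod : ∀ v : V → A, ∏ u, v u = v i := fun v => Fintype.prod_subsingleton v i
      -- The vertices after ECO 2 are just `some i` and `none`. The condition says that no edge
      -- joins them, that is, the loop separates the surface.
      by_cases hS : ∀ x : γ'.H, γ'.vert (γ'.inv x) ∈ ({some i} : Set (Option V)) ↔
          γ'.vert x ∈ ({some i} : Set (Option V))
      · have key : ∀ S : Set (Option V), Nonempty S → Subsingleton S →
            ∀ hS : ∀ x : γ'.H, γ'.vert (γ'.inv x) ∈ S ↔ γ'.vert x ∈ S,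
            ∃ g : ℕ, (γ'.restrict S hS).eulerChar = 2 - 2 * (g : ℤ) ∧ ∀ (v : S → A) (a : S),
              ω.val (γ'.restrict S hS) v = F.counit (v a * F.euler ^ g) := by
          intro S _ _ hS
          obtain ⟨g, h1, h2⟩ := ih _ ((Finite.card_subtype_le
            (fun x : γ'.H => γ'.vert x ∈ S)).trans_lt (hlt h)) (γ'.restrict S hS) rfl
            (connected_of_subsingleton _)
          exact ⟨g, h1, fun v a => by rw [h2, Fintype.prod_subsingleton v a]⟩
        have hcompl : ({some i}ᶜ : Set (Option V)) = {none} := by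
          ext u
          cases u with
          | none => simp
          | some u => simp [Subsingleton.elim u i]
        obtain ⟨g₁, h1, h1'⟩ := key {some i} ⟨some i, rfl⟩
          ⟨fun x y => Subtype.ext (x.2.trans y.2.symm)⟩ hS
        obtain ⟨g₂, h2, h2'⟩ := key {some i}ᶜ ⟨none, by simp⟩
          ⟨fun x y => Subtype.ext ((hcompl ▸ x.2 : x.1 ∈ ({none} : Set (Option V))).trans
            (hcompl ▸ y.2 : y.1 ∈ ({none} : Set (Option V))).symm)⟩ (fun x => not_congr (hS x))
        -- The genera add up: `χ(γ) + 2 = (2 - 2g₁) + (2 - 2g₂)`.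
        refine ⟨g₁ + g₂, ?_, fun v => ?_⟩
        · have := γ'.eulerChar_restrict {some i} hS
          rw [h1, h2, hχ] at this
          push_cast
          linarith
        · rw [ω.eco_two γ hγ h hl, F.lift_comul _ (F.euler ^ g₁) (F.euler ^ g₂), hprod, pow_add,
            mul_assoc]
          intro a b
          rw [splitEval, LinearMap.mk₂_apply, ω.val_union _ _ hS, h1' _ ⟨some i, rfl⟩,
            h2' _ ⟨none, by simp⟩]
          simp [hi]
      · have hcon : γ'.Connected := by
          have hmem : ∀ {u : Option V}, u ≠ some i → u = none := fun {u} hu => by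
            cases u with
            | none => rfl
            | some u => exact (hu (by rw [Subsingleton.elim u i])).elim
          have hadj : γ'.Adj (some i) none ∧ γ'.Adj none (some i) := by
            push Not at hS
            obtain ⟨x, ⟨h1, h2⟩ | ⟨h1, h2⟩⟩ := hS
            · exact ⟨⟨γ'.inv x, h1, by rw [γ'.inv_inv]; exact hmem h2⟩, ⟨x, hmem h2, h1⟩⟩
            · exact ⟨⟨x, h2, hmem h1⟩, ⟨γ'.inv x, hmem h1, by rw [γ'.inv_inv]; exact h2⟩⟩
          refine ⟨inferInstance, fun u w => ?_⟩
          by_cases hu : u = some i <;> by_cases hw : w = some i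
          · rw [hu, hw]
          · rw [hu, hmem hw]; exact .single hadj.1
          · rw [hmem hu, hw]; exact .single hadj.2
          · rw [hmem hu, hmem hw]
        obtain ⟨g, h1, h2⟩ := ih _ (hlt h) γ' rfl hcon
        -- A non-separating loop accounts for one handle: `χ(γ) = (2 - 2g) - 2`.
        refine ⟨g + 1, by push_cast; linarith, fun v => ?_⟩
        rw [ω.eco_two γ hγ h hl, F.lift_comul' _ (F.euler ^ g), hprod, pow_succ']
        intro a b
        rw [splitEval, LinearMap.mk₂_apply, h2, Fintype.prod_option,
          Fintype.prod_subsingleton _ i]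
        simp [hi, mul_comm]
  · push Not at hloop
    obtain ⟨h, hne⟩ := hloop
    obtain ⟨g, h1, h2⟩ := ih _ (hlt h) (γ.contractEdge h hne) rfl
      (connected_contractEdge hγ h hne)
    refine ⟨g, by rw [← h1, eulerChar_contractEdge], fun v => ?_⟩
    rw [ω.eco_one γ hγ h hne, h2]
    congr 2
    -- The merged entry is written as its own factor times a correction supported at one vertex, so
    -- that the product over the remaining vertices regains the entry of the vertex contracted away.
    have : ∀ u : {u : V // u ≠ γ.vert (γ.inv h)},
        (if u.1 = γ.vert h then v (γ.vert h) * v (γ.vert (γ.inv h)) else v u) =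
          v u * if u = ⟨γ.vert h, hne⟩ then v (γ.vert (γ.inv h)) else 1 := by
      rintro ⟨u, hu⟩
      by_cases he : u = γ.vert h <;> simp [he]
    rw [Finset.prod_congr rfl fun u _ => this u, Finset.prod_mul_distrib, Finset.prod_ite_eq',
      if_pos (Finset.mem_univ _), Fintype.prod_eq_mul_prod_subtype_ne _ (γ.vert (γ.inv h)),
      mul_comm]

end ECOFunctor

/-! ### Existence of cell graphs of every type -/

namespace CellPerm

open Equiv Equiv.Perm

/-- With `q` the edge involution, a cut of the rotation becomes a cut of the face permutation, at
the opposite half-edges. -/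
theorem cut_mul {α : Type*} (p q : Perm α) (h k : α) :
    cut p (q h) (q k) * q = cut (p * q) h k := by
  simp only [cut, mul_assoc, ← mul_swap_eq_swap_mul]

theorem sameCycle_addRight {G : Type*} [AddGroup G] (c x y : G) :
    (Equiv.addRight c).SameCycle x y ↔ ∃ i : ℤ, i • c = -x + y := by
  have h : ∀ i : ℤ, (Equiv.addRight c ^ i) x = x + i • c := fun i => by
    induction i using Int.induction_on with
    | zero => simp
    | succ i ih =>
      rw [add_comm, zpow_one_add, Perm.mul_apply, ih, add_comm 1, add_one_zsmul]
      exact add_assoc _ _ _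
    | pred i ih =>
      rw [sub_eq_neg_add, zpow_add, zpow_neg_one, Perm.mul_apply, ih, Perm.inv_eq_iff_eq]
      refine Eq.trans ?_ (add_assoc _ _ _).symm
      change _ = x + ((-1 + -(i : ℤ)) • c + c)
      rw [← add_one_zsmul, neg_add_cancel_comm]
  exact exists_congr fun i => by rw [h, eq_neg_add_iff_add_eq]

/-- The cycles of a translation are the cosets of the subgroup generated by `c`; this is Lagrange's
theorem. -/
theorem numCycles_addRight_mul {N : ℕ} [NeZero N] (c : ZMod N) :
    numCycles (Equiv.addRight c) * addOrderOf c = N := by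
  have hcard : numCycles (Equiv.addRight c) =
      Nat.card (ZMod N ⧸ AddSubgroup.zmultiples c) := by
    refine Nat.card_congr (Quotient.congr (Equiv.refl _) fun x y => ?_)
    change (Equiv.addRight c).SameCycle x y ↔ (QuotientAddGroup.leftRel _) x y
    rw [QuotientAddGroup.leftRel_apply, AddSubgroup.mem_zmultiples_iff, sameCycle_addRight]
  rw [hcard, ← Nat.card_zmultiples, ← AddSubgroup.card_eq_card_quotient_mul_card_addSubgroup,
    Nat.card_zmod]

/-- Two permutations that generate a transitive group, and have the numbers of cycles of the
rotation and the edge involution of a connected cell graph of genus `g` with `n` vertices and two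
faces. -/
theorem exists_perm_of_genus (g n : ℕ) : ∃ (H : Type) (_ : Finite H) (_ : Nonempty H)
    (σ τ : Perm H), (∀ x, τ (τ x) = x) ∧ (∀ x, τ x ≠ x) ∧
      (∀ R : H → H → Prop, Equivalence R → (∀ x, R x (σ x)) → (∀ x, R x (τ x)) → ∀ x y, R x y) ∧
      numCycles σ = n + 1 ∧ numCycles τ = n + 1 + 2 * g ∧ numCycles (σ * τ) = 2 := by
  induction n with
  | zero =>
    -- The graph has one vertex with `4g + 2` half-edges in cyclic order, opposite ones being
    -- joined. The face permutation is translation by `2g + 2`, of order `2g + 1` as `gcd(4g + 2, 2g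
    -- + 2) = 2`, so there are two faces.
    have hN : 4 * g + 2 = 2 * (2 * g + 1) := by ring
    have hτ : addOrderOf ((2 * g + 1 : ℕ) : ZMod (4 * g + 2)) = 2 := by
      rw [ZMod.addOrderOf_coe _ (by omega), hN, Nat.gcd_mul_left_left,
        Nat.mul_div_cancel _ (by omega)]
    have hφ : addOrderOf ((2 * g + 2 : ℕ) : ZMod (4 * g + 2)) = 2 * g + 1 := by
      have h1 : Nat.gcd (2 * g + 1) (g + 1) = 1 := by
        rw [show 2 * g + 1 = g + (g + 1) by ring, Nat.gcd_add_self_left]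
        simp
      rw [ZMod.addOrderOf_coe _ (by omega), hN, show 2 * g + 2 = 2 * (g + 1) by ring,
        Nat.gcd_mul_left, h1]
      omega
    refine ⟨ZMod (4 * g + 2), inferInstance, inferInstance, Equiv.addRight 1,
      Equiv.addRight ((2 * g + 1 : ℕ) : ZMod (4 * g + 2)), fun x => ?_, fun x => ?_, ?_, ?_, ?_, ?_⟩
    · have := addOrderOf_nsmul_eq_zero ((2 * g + 1 : ℕ) : ZMod (4 * g + 2))
      rw [hτ, two_nsmul] at this
      rw [Equiv.coe_addRight]
      exact (add_assoc _ _ _).trans ((congrArg _ this).trans (add_zero x))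
    · rw [Equiv.coe_addRight, Ne, add_eq_left, ← AddMonoid.addOrderOf_eq_one_iff, hτ]
      decide
    · intro R hR hσ _ x y
      refine sameCycle_le hR hσ ((sameCycle_addRight _ _ _).2 ⟨((-x + y).val : ℤ), ?_⟩)
      simp
    · have := numCycles_addRight_mul (1 : ZMod (4 * g + 2))
      rw [ZMod.addOrderOf_one] at this
      exact Nat.eq_of_mul_eq_mul_right (by omega : 0 < 4 * g + 2) (by rw [this]; ring)
    · have := numCycles_addRight_mul ((2 * g + 1 : ℕ) : ZMod (4 * g + 2))
      rw [hτ] at this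
      omega
    · have := numCycles_addRight_mul ((2 * g + 2 : ℕ) : ZMod (4 * g + 2))
      rw [hφ] at this
      have he : Equiv.addRight (1 : ZMod (4 * g + 2)) *
          Equiv.addRight ((2 * g + 1 : ℕ) : ZMod (4 * g + 2)) =
          Equiv.addRight ((2 * g + 2 : ℕ) : ZMod (4 * g + 2)) := by
        ext x
        rw [Perm.mul_apply, Equiv.coe_addRight, Equiv.coe_addRight, Equiv.coe_addRight]
        push_cast
        ring_nf
      rw [he]
      exact Nat.eq_of_mul_eq_mul_right (by omega : 0 < 2 * g + 1) (by rw [this]; ring)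
  | succ n ih =>
    classical
    obtain ⟨H, _, ⟨x₀⟩, σ, τ, h1, h2, h3, h4, h5, h6⟩ := ih
    -- A pendant edge with halves `false` and `true` is attached: `false` is inserted at the vertex
    -- of `x₀`, and `true` is alone at a new vertex. The joining cut absorbs the single face of the
    -- new edge into an old one, so there are still two faces.
    set s : Perm Bool := cut 1 false true with hs
    have hs0 : s false = true := cut_left _ _ _
    have hs1 : s true = false := cut_right _ _ _
    have hone : numCycles (1 : Perm Bool) = 2 := by
      rw [numCycles_eq_card fun _ => rfl, Nat.card_eq_fintype_card, Fintype.card_bool]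
    have hsc : numCycles s + 1 = 2 := by
      rw [← hone]
      refine numCycles_cut_of_not_sameCycle _ fun h => ?_
      exact absurd (sameCycle_le (R := Eq) eq_equivalence (fun _ => rfl) h) (by decide)
    set σ' := cut (Perm.sumCongr σ (1 : Perm Bool)) (Sum.inl x₀) (Sum.inr false) with hσ'
    set τ' := Perm.sumCongr τ s with hτ'
    have hφ : σ' * τ' = cut (Perm.sumCongr (σ * τ) s) (Sum.inl (τ x₀)) (Sum.inr true) := by
      have e1 : Perm.sumCongr (σ * τ) s = Perm.sumCongr σ (1 : Perm Bool) * τ' := by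
        rw [hτ', Perm.sumCongr_mul, one_mul]
      have e2 : τ' (Sum.inl (τ x₀)) = Sum.inl x₀ := congrArg Sum.inl (h1 x₀)
      have e3 : τ' (Sum.inr true) = Sum.inr false := congrArg Sum.inr hs1
      rw [e1, ← cut_mul, e2, e3]
    refine ⟨H ⊕ Bool, inferInstance, inferInstance, σ', τ', ?_, ?_, ?_, ?_, ?_, ?_⟩
    · rintro (x | _ | _)
      exacts [congrArg Sum.inl (h1 x), congrArg Sum.inr ((congrArg s hs0).trans hs1),
        congrArg Sum.inr ((congrArg s hs1).trans hs0)]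
    · rintro (x | _ | _) e
      · exact h2 x (Sum.inl_injective e)
      · exact absurd (hs0.symm.trans (Sum.inr_injective e)) (by decide)
      · exact absurd (hs1.symm.trans (Sum.inr_injective e)) (by decide)
    · intro R hR hRσ hRτ
      have hf : R (Sum.inl x₀) (Sum.inr false) := by
        have := hRσ (Sum.inl x₀)
        rwa [hσ', cut_left] at this
      have hft : R (Sum.inr false) (Sum.inr true) := by
        have := hRτ (Sum.inr false)
        rwa [show τ' (Sum.inr false) = Sum.inr true from congrArg Sum.inr hs0] at this
      have hH : ∀ x y, R (Sum.inl x) (Sum.inl y) := by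
        refine h3 (fun x y => R (Sum.inl x) (Sum.inl y)) (hR.comap Sum.inl) (fun x => ?_)
          fun x => hRτ (Sum.inl x)
        by_cases hx : x = x₀
        · have := hRσ (Sum.inr false)
          rw [hσ', cut_right] at this
          rw [hx]
          exact hR.trans hf this
        · have := hRσ (Sum.inl x)
          rwa [hσ', cut_of_ne _ (fun e => hx (Sum.inl_injective e)) Sum.inl_ne_inr] at this
      have hto : ∀ z, R (Sum.inl x₀) z := by
        rintro (x | _ | _)
        exacts [hH _ _, hf, hR.trans hf hft]
      exact fun x y => hR.trans (hR.symm (hto x)) (hto y)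
    · have := numCycles_cut_of_not_sameCycle _
        (not_sameCycle_sumCongr σ (1 : Perm Bool) x₀ false)
      rw [numCycles_sumCongr, hone, h4] at this
      exact Nat.succ_injective this
    · rw [hτ', numCycles_sumCongr, h5]
      omega
    · have := numCycles_cut_of_not_sameCycle _ (not_sameCycle_sumCongr (σ * τ) s (τ x₀) true)
      rw [numCycles_sumCongr, h6] at this
      rw [hφ]
      omega

end CellPerm

namespace CellGraph

open CellPerm Equiv Equiv.Perm

theorem nonempty_ofType (g n : ℕ) [NeZero n] : (ofType g n).Nonempty := by
  obtain ⟨m, rfl⟩ := Nat.exists_eq_succ_of_ne_zero (NeZero.ne n)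
  obtain ⟨H, _, _, σ, τ, h1, h2, h3, h4, h5, h6⟩ := exists_perm_of_genus g m
  let e : Quotient (SameCycle.setoid σ) ≃ Fin (m + 1) := Finite.equivFinOfCardEq h4
  let γ : CellGraph (Fin (m + 1)) :=
    { H := H
      rot := σ
      inv := τ
      inv_inv := h1
      inv_ne := h2
      vert := fun x => e (Quotient.mk _ x)
      vert_eq_iff := fun x y => by
        rw [e.apply_eq_iff_eq]
        exact Quotient.eq }
  have hsymm : ∀ {u v}, Relation.ReflTransGen γ.Adj u v → Relation.ReflTransGen γ.Adj v u := by
    intro u v h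
    induction h with
    | refl => exact .refl
    | tail _ h ih =>
      obtain ⟨x, rfl, rfl⟩ := h
      exact .head ⟨γ.inv x, rfl, by rw [γ.inv_inv]⟩ ih
  refine ⟨γ, ⟨inferInstance, fun u v => ?_⟩, ?_⟩
  · obtain ⟨x, rfl⟩ := (e.surjective.comp Quotient.mk_surjective) u
    obtain ⟨y, rfl⟩ := (e.surjective.comp Quotient.mk_surjective) v
    refine h3 (fun x y => Relation.ReflTransGen γ.Adj (γ.vert x) (γ.vert y))
      ⟨fun _ => .refl, hsymm, fun h h' => h.trans h'⟩ (fun x => ?_) (fun x => ?_) x y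
    · rw [show σ x = γ.rot x from rfl, γ.vert_rot]
    · exact .single ⟨x, rfl, rfl⟩
  · rw [eulerChar_eq]
    -- The count is `2(m+1) - (m+1) - (m+1+2g) + 2 = 2 - 2g`.
    change 2 * (Nat.card (Fin (m + 1)) : ℤ) - numCycles σ - numCycles τ + numCycles (σ * τ) = _
    rw [h4, h5, h6, Nat.card_fin]
    push_cast
    ring

end CellGraph

/-! ### The field theory of an ECO functor -/

theorem mainTheorem4 {K A : Type*} [Field K] [CharZero K] [CommRing A] [Nontrivial A] [Algebra K A]
    [FiniteDimensional K A] (F : FrobeniusStructure K A) (ω : ECOFunctor F) :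
    ∃ W : ∀ (_ n : ℕ) [NeZero n], MultilinearMap K (fun _ : Fin n => A) K,
      (∀ (g n : ℕ) [NeZero n], (CellGraph.ofType g n).Nonempty ∧
        ∀ γ ∈ CellGraph.ofType g n, ω.val γ = W g n) ∧
      (∀ (g n : ℕ) [NeZero n] (v : Fin n → A), W g n v = F.counit ((∏ i, v i) * F.euler ^ g)) ∧
      IsTQFT F W := by
  refine ⟨fun g n _ => F.omega g n, fun g n _ => ⟨CellGraph.nonempty_ofType g n, ?_⟩,
    fun g n _ v => F.omega_apply g n v, F.isTQFT_omega⟩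
  rintro γ ⟨hγ, hχ⟩
  obtain ⟨g', h1, h2⟩ := ω.exists_genus_val_eq _ γ rfl hγ
  -- The Euler characteristic determines the genus.
  obtain rfl : g' = g := by omega
  ext v
  rw [h2, F.omega_apply]
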